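/- Let $S=\mathrm{Sym}(\omega)$ be the group of all permutations of the natural numbers, and let $CF(S)$ be the set of all regular cardinals $\lambda$ such that $S=\bigcup_{i<\lambda}G_i$ for some increasing chain $\langle G_i\mid i<\lambda\rangle$ of proper subgroups (that is, $G_i\subseteq G_j$ for $i\le j<\lambda$). For a cardinal $\kappa$, let $MA_\kappa$ be the statement that for every nonempty notion of forcing $\mathbb P$ with the countable chain condition and every family $\mathcal D$ of at most $\kappa$ dense subsets of $\mathbb P$ there is a filter $G\subseteq\mathbb P$ with $G\cap D\neq\emptyset$ for all $D\in\mathcal D$. **Theorem 2.2.** Assume $MA_\kappa$. Let $\langle\lambda_\alpha\mid\alpha<\kappa\rangle$ be a strictly increasing sequence of cardinals with $\lambda_\alpha\in CF(S)$ for all $\alpha<\kappa$, and let $\mathcal D$ be a nonprincipal ultrafilter on $\kappa$. Suppose that $\mathrm{tcf}\left(\prod_{\alpha<\kappa}\lambda_\alpha/\mathcal D\right)=\lambda$; that is, $\lambda$ is a regular cardinal and there is a sequence $\langle f_\beta\mid\beta<\lambda\rangle$ in $\prod_{\alpha<\kappa}\lambda_\alpha$ such that $\{\alpha<\kappa\mid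 f_\beta(\alpha)<f_\gamma(\alpha)\}\in\mathcal D$ whenever $\beta<\gamma<\lambda$, and for every $h\in\prod_{\alpha<\kappa}\lambda_\alpha$ there is $\beta<\lambda$ with $\{\alpha<\kappa\mid h(\alpha)<f_\beta(\alpha)\}\in\mathcal D$. Then $\lambda\in CF(S)$. -/

import Mathlib

namespace CofSpectrum

universe u

/-- The cofinality spectrum `CF(G)` of a group: the regular (in particular infinite) cardinals `c`
such that `G` is the union of an increasing chain `⟨H i | i < c⟩` of proper subgroups. The
ordinals below the initial ordinal of `c` are represented by the well-ordered type
`c.ord.ToType`. -/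
def CF (G : Type u) [Group G] : Set Cardinal.{u} :=
  {c | c.IsRegular ∧ ∃ H : c.ord.ToType → Subgroup G,
    Monotone H ∧ (∀ i, H i ≠ ⊤) ∧ ∀ g : G, ∃ i, g ∈ H i}

/-- `μ` is the true cofinality of the reduced product of the cardinals `lam i` modulo the filter
`F`: `μ` is regular and some `μ`-sequence in the product is strictly increasing modulo `F` and
cofinal modulo `F`. -/
def IsTrueCofinality {I : Type u} (F : Filter I) (lam : I → Cardinal.{u}) (μ : Cardinal.{u}) :
    Prop :=
  μ.IsRegular ∧ ∃ f : μ.ord.ToType → (i : I) → (lam i).ord.ToType,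
    (∀ a b, a < b → ∀ᶠ i in F, f a i < f b i) ∧
    ∀ h : (i : I) → (lam i).ord.ToType, ∃ a, ∀ᶠ i in F, h i < f a i

/-- Two conditions are compatible if they have a common strengthening (`r ≤ p` means that `r`
is stronger than `p`). -/
def Compatible {P : Type u} [Preorder P] (p q : P) : Prop :=
  ∃ r, r ≤ p ∧ r ≤ q

/-- The countable chain condition: every set of pairwise incompatible conditions is countable. -/
def CCC (P : Type u) [Preorder P] : Prop :=
  ∀ A : Set P, (A.Pairwise fun p q => ¬ Compatible p q) → A.Countable

/-- `D` is a dense set of conditions. -/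
def IsDense {P : Type u} [Preorder P] (D : Set P) : Prop :=
  ∀ p, ∃ d ∈ D, d ≤ p

/-- Martin's axiom `MA_κ`: for every nonempty c.c.c. notion of forcing and every family of at most
`κ` dense sets, some filter meets every member of the family. -/
def MA (κ : Cardinal.{u}) : Prop :=
  ∀ (P : Type u) [Preorder P] [Nonempty P], CCC P →
    ∀ 𝒟 : Set (Set P), Cardinal.mk 𝒟 ≤ κ → (∀ D ∈ 𝒟, IsDense D) →
      ∃ G : Order.PFilter P, ∀ D ∈ 𝒟, ∃ p ∈ D, p ∈ G

end CofSpectrum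

/-! For `b` below `μ`, take the permutations `g` lying in `H α (f b α)` for `D`-almost all `α`.
These subgroups increase because `f` does modulo `D`. They exhaust the group because, for fixed `g`,
a choice of levels containing `g` is bounded modulo `D` by some `f b`. Only properness needs
Martin's axiom. When `lam α` is uncountable, every member of its chain has uncountable codimension,
so it suffices that `κ` many such subgroups never cover Sym(ℕ) (`MA.exists_forall_notMem`). Infinite
sets `Z ⊆ ℕ` are coded by permutations `nodeSwap (nextElt Z)`. For each subgroup, the sets all of
whose infinite subsets have codes outside it form a dense family closed under almost-subsets, and
`MA κ` gives a common member of `κ` such families (`MA.exists_mem_forall_of_dense`). Density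
(`exists_dense_nodeSwap_notMem`) is a guessing argument. A sequence `t` lists the finitely supported
permutations along `X`, and every permutation is a product of two that `t` guesses infinitely often
(`exists_eq_mul_of_listsFinitary`). Hence a guessed `s` is missing from the subgroup even after
finitely many elements are added. The code of any infinite set of correct guesses, together with two
of these elements, generates `s`, so that code is missing too. -/

namespace CofSpectrum
-- Martin's axiom: pseudo-intersections and common members of dense families
open Cardinal

/-- The conditions of the forcing that adds a pseudo-intersection of a family of sets: a finite
part of the pseudo-intersection, and finitely many members of the family that later elements have
to belong to. -/
structure PseudoCond {ι : Type} (X : ι → Set ℕ) where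
  stem : Finset ℕ
  side : Finset ι

namespace PseudoCond

variable {ι : Type} {X : ι → Set ℕ}

instance : Preorder (PseudoCond X) where
  le p q := q.stem ⊆ p.stem ∧ q.side ⊆ p.side ∧
    ∀ n ∈ p.stem, n ∉ q.stem → ∀ i ∈ q.side, n ∈ X i
  le_refl p := ⟨fun _ h => h, fun _ h => h, fun _ h h' => absurd h h'⟩
  le_trans p q r hpq hqr := by
    refine ⟨hqr.1.trans hpq.1, hqr.2.1.trans hpq.2.1, fun n hn hnr i hi => ?_⟩
    by_cases h : n ∈ q.stem
    · exact hqr.2.2 n h hnr i hi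
    · exact hpq.2.2 n hn h i (hqr.2.1 hi)

theorem le_def {p q : PseudoCond X} : p ≤ q ↔ q.stem ⊆ p.stem ∧ q.side ⊆ p.side ∧
    ∀ n ∈ p.stem, n ∉ q.stem → ∀ i ∈ q.side, n ∈ X i := Iff.rfl

instance : Nonempty (PseudoCond X) := ⟨⟨∅, ∅⟩⟩

theorem compatible_of_stem_eq {p q : PseudoCond X} (h : p.stem = q.stem) : Compatible p q := by
  classical
  refine ⟨⟨p.stem, p.side ∪ q.side⟩, ⟨fun _ h => h, Finset.subset_union_left, ?_⟩,
    ⟨h ▸ fun _ h => h, Finset.subset_union_right, ?_⟩⟩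
  · exact fun n hn hn' => absurd hn hn'
  · exact fun n hn hn' => absurd (h ▸ hn) hn'

/-- There are only countably many stems, and conditions with equal stems are compatible. -/
theorem ccc : CCC (PseudoCond X) := by
  intro A hA
  refine Set.MapsTo.countable_of_injOn (f := stem) (t := Set.univ) (fun _ _ => Set.mem_univ _) ?_
    Set.countable_univ
  intro p hp q hq h
  by_contra hne
  exact hA hp hq hne (compatible_of_stem_eq h)

theorem isDense_side (i : ι) : IsDense {p : PseudoCond X | i ∈ p.side} := by
  classical
  intro p
  exact ⟨⟨p.stem, insert i p.side⟩, Finset.mem_insert_self _ _, fun _ h => h,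
    Finset.subset_insert _ _, fun n hn hn' => absurd hn hn'⟩

theorem isDense_stem (hX : ∀ F : Finset ι, (⋂ i ∈ F, X i).Infinite) (k : ℕ) :
    IsDense {p : PseudoCond X | ∃ n ∈ p.stem, k < n} := by
  intro p
  obtain ⟨n, hn, hkn⟩ := (hX p.side).exists_gt k
  refine ⟨⟨insert n p.stem, p.side⟩, ⟨n, Finset.mem_insert_self _ _, hkn⟩,
    Finset.subset_insert _ _, fun _ h => h, fun m hm hm' i hi => ?_⟩
  obtain rfl : m = n := (Finset.mem_insert.1 hm).resolve_right hm'
  exact Set.mem_iInter₂.1 hn i hi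

end PseudoCond

theorem MA.exists_pseudoIntersection {κ : Cardinal.{0}} (hMA : MA κ) (hκ : ℵ₀ ≤ κ) {ι : Type}
    (hι : #ι ≤ κ) (X : ι → Set ℕ) (hX : ∀ F : Finset ι, (⋂ i ∈ F, X i).Infinite) :
    ∃ Z : Set ℕ, Z.Infinite ∧ ∀ i, (Z \ X i).Finite := by
  let E : ι ⊕ ℕ → Set (PseudoCond X) :=
    Sum.elim (fun i => {p | i ∈ p.side}) (fun k => {p | ∃ n ∈ p.stem, k < n})
  have hE : ∀ D ∈ Set.range E, IsDense D := by
    rintro _ ⟨i | k, rfl⟩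
    · exact PseudoCond.isDense_side i
    · exact PseudoCond.isDense_stem hX k
  have hcard : #(Set.range E) ≤ κ := by
    refine mk_range_le.trans ?_
    rw [mk_sum, lift_id, lift_id]
    exact add_le_of_le hκ hι (by simpa using hκ)
  obtain ⟨G, hG⟩ := hMA _ PseudoCond.ccc _ hcard hE
  refine ⟨{n | ∃ p ∈ G, n ∈ p.stem}, ?_, fun i => ?_⟩
  · refine Set.infinite_of_forall_exists_gt fun k => ?_
    obtain ⟨p, ⟨n, hn, hkn⟩, hp⟩ := hG _ ⟨Sum.inr k, rfl⟩
    exact ⟨n, ⟨p, hp, hn⟩, hkn⟩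
  · obtain ⟨p, hpi, hp⟩ := hG _ ⟨Sum.inl i, rfl⟩
    refine p.stem.finite_toSet.subset ?_
    rintro n ⟨⟨q, hq, hn⟩, hni⟩
    by_contra hnp
    obtain ⟨r, -, hrp, hrq⟩ := G.directed p hp q hq
    exact hni ((PseudoCond.le_def.1 hrp).2.2 n ((PseudoCond.le_def.1 hrq).1 hn) hnp i hpi)

/-- Under `MA κ`, at most `κ` many dense families of infinite sets of natural numbers, each closed
under almost-subsets, have a common member. -/
theorem MA.exists_mem_forall_of_dense {κ : Cardinal.{0}} (hMA : MA κ) (hκ : ℵ₀ ≤ κ) {I : Type}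
    [LinearOrder I] [WellFoundedLT I] (hI : #I ≤ κ) (𝒟 : I → Set (Set ℕ))
    (hmono : ∀ i, ∀ X ∈ 𝒟 i, ∀ Y : Set ℕ, Y.Infinite → (Y \ X).Finite → Y ∈ 𝒟 i)
    (hdense : ∀ i, ∀ X : Set ℕ, X.Infinite → ∃ Y ⊆ X, Y.Infinite ∧ Y ∈ 𝒟 i) :
    ∃ X : Set ℕ, X.Infinite ∧ ∀ i, X ∈ 𝒟 i := by
  classical
  let P (i : I) (prev : ∀ j, j < i → Set ℕ) (Y : Set ℕ) : Prop :=
    Y.Infinite ∧ Y ∈ 𝒟 i ∧ ∀ j (h : j < i), (Y \ prev j h).Finite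
  -- The recursion builds a tower decreasing modulo finite sets. The default `Set.univ` is never
  -- used, by `key`.
  let step (i : I) (prev : ∀ j, j < i → Set ℕ) : Set ℕ :=
    if h : ∃ Y, P i prev Y then h.choose else Set.univ
  let T : I → Set ℕ := (wellFounded_lt (α := I)).fix step
  have hT : ∀ i, T i = step i fun j _ => T j := fun i => WellFounded.fix_eq _ _ _
  have hinter : ∀ J : Set I, (∀ i ∈ J, P i (fun j _ => T j) (T i)) →
      ∃ Z : Set ℕ, Z.Infinite ∧ ∀ i ∈ J, (Z \ T i).Finite := by
    intro J hJ
    obtain ⟨Z, hZ, hZT⟩ := hMA.exists_pseudoIntersection hκ ((mk_set_le J).trans hI)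
      (fun i : J => T i) (by
        intro F
        rcases F.eq_empty_or_nonempty with rfl | hF
        · simpa using Set.infinite_univ
        · have hm := hJ (F.max' hF) (F.max' hF).2
          -- The set of largest index is almost contained in the others, so finitely many members of
          -- the tower meet in an infinite set.
          refine Set.Infinite.mono (s := T (F.max' hF) \ ⋃ i ∈ F, (T (F.max' hF) \ T i)) ?_
            (hm.1.sdiff (F.finite_toSet.biUnion fun i hi => ?_))
          · intro n hn
            simp only [Set.mem_sdiff, Set.mem_iUnion, not_exists, not_and, not_not] at hn
            exact Set.mem_iInter₂.2 fun i hi => hn.2 i hi hn.1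
          · rcases (F.le_max' i hi).eq_or_lt with h | h
            · rw [← h]; simp
            · exact hm.2.2 i h)
    exact ⟨Z, hZ, fun i hi => hZT ⟨i, hi⟩⟩
  have key : ∀ i, P i (fun j _ => T j) (T i) := by
    intro i
    induction i using WellFoundedLT.induction with
    | ind i ih =>
      have hex : ∃ Y, P i (fun j _ => T j) Y := by
        obtain ⟨Z, hZ, hZT⟩ := hinter (Set.Iio i) ih
        obtain ⟨Y, hYZ, hY, hYD⟩ := hdense i Z hZ
        exact ⟨Y, hY, hYD, fun j hj => (hZT j hj).subset (Set.sdiff_subset_sdiff_left hYZ)⟩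
      have : T i = hex.choose := by rw [hT]; exact dif_pos hex
      rw [this]
      exact hex.choose_spec
  obtain ⟨Z, hZ, hZT⟩ := hinter Set.univ fun i _ => key i
  exact ⟨Z, hZ, fun i => hmono i _ (key i).2.1 Z hZ (hZT i trivial)⟩

end CofSpectrum
namespace CofSpectrum
open Equiv

/-! ### Generating the symmetric group from the permutations supported in one set -/

section Generation

variable {Ω : Type*} [Countable Ω]

theorem exists_bijOn_of_infinite {Q R : Set Ω} (hQ : Q.Infinite) (hR : R.Infinite) :
    ∃ f : Ω → Ω, Set.BijOn f Q R := by
  classical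
  have := hQ.to_subtype
  have := hR.to_subtype
  obtain ⟨e⟩ := nonempty_equiv_of_countable (α := Q) (β := R)
  refine ⟨fun x => if h : x ∈ Q then e ⟨x, h⟩ else x, fun x hx => ?_, fun x hx y hy h => ?_,
    fun y hy => ⟨e.symm ⟨y, hy⟩, (e.symm ⟨y, hy⟩).2, by simp⟩⟩
  · simp [hx]
  · simp only [hx, hy, dif_pos] at h
    simpa using e.injective (Subtype.ext h)

/-- A bijection between two subsets of `E` with infinite complements in `E` extends to a permutation
that is the identity outside `E`. -/
theorem exists_perm_eqOn {f : Ω → Ω} {Q R E : Set Ω} (hf : Set.BijOn f Q R) (hQE : Q ⊆ E)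
    (hRE : R ⊆ E) (hQ : (E \ Q).Infinite) (hR : (E \ R).Infinite) :
    ∃ k : Perm Ω, Set.EqOn k f Q ∧ ∀ x ∉ E, k x = x := by
  classical
  obtain ⟨g, hg⟩ := exists_bijOn_of_infinite hQ hR
  have hu : Set.BijOn (Q.piecewise f g) (Q ∪ E \ Q) (R ∪ E \ R) := by
    refine ((hf.congr (Set.piecewise_eqOn Q f g).symm)).union (hg.congr ?_) ?_
    · exact fun x hx => (Set.piecewise_eq_of_notMem _ _ _ hx.2).symm
    · rintro x (hx | hx) y (hy | hy) h
      · simp only [Set.piecewise_eq_of_mem _ _ _ hx, Set.piecewise_eq_of_mem _ _ _ hy] at h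
        exact hf.injOn hx hy h
      · simp only [Set.piecewise_eq_of_mem _ _ _ hx, Set.piecewise_eq_of_notMem _ _ _ hy.2] at h
        exact absurd (h ▸ hf.mapsTo hx) (hg.mapsTo hy).2
      · simp only [Set.piecewise_eq_of_notMem _ _ _ hx.2, Set.piecewise_eq_of_mem _ _ _ hy] at h
        exact absurd (h ▸ hf.mapsTo hy) (hg.mapsTo hx).2
      · simp only [Set.piecewise_eq_of_notMem _ _ _ hx.2,
          Set.piecewise_eq_of_notMem _ _ _ hy.2] at h
        exact hg.injOn hx hy h
  rw [Set.union_sdiff_cancel hQE, Set.union_sdiff_cancel hRE] at hu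
  have hb : Function.Bijective (E.piecewise (Q.piecewise f g) id) := by
    constructor
    · intro x y h
      by_cases hx : x ∈ E <;> by_cases hy : y ∈ E <;> simp only [hx, hy, not_false_eq_true,
        Set.piecewise_eq_of_mem, Set.piecewise_eq_of_notMem, id] at h
      · exact hu.injOn hx hy h
      · exact absurd (h ▸ hu.mapsTo hx) hy
      · exact absurd (h ▸ hu.mapsTo hy) hx
      · exact h
    · intro y
      by_cases hy : y ∈ E
      · obtain ⟨x, hx, rfl⟩ := hu.surjOn hy
        exact ⟨x, by simp [hx]⟩
      · exact ⟨y, by simp [hy]⟩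
  refine ⟨Equiv.ofBijective _ hb, fun x hx => ?_, fun x hx => ?_⟩
  · simp [hQE hx, hx]
  · simp [hx]

theorem exists_disjoint_infinite_subsets {A : Set Ω} (hA : A.Infinite) :
    ∃ Q ⊆ A, ∃ R ⊆ A, Disjoint Q R ∧ Q.Infinite ∧ R.Infinite := by
  have := hA.to_subtype
  obtain ⟨e⟩ := nonempty_equiv_of_countable (α := A ⊕ A) (β := A)
  have hl : Function.Injective fun a : A => (e (Sum.inl a) : Ω) :=
    Subtype.val_injective.comp (e.injective.comp Sum.inl_injective)
  have hr : Function.Injective fun a : A => (e (Sum.inr a) : Ω) :=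
    Subtype.val_injective.comp (e.injective.comp Sum.inr_injective)
  refine ⟨_, Set.range_subset_iff.2 fun a => (e (Sum.inl a)).2, _,
    Set.range_subset_iff.2 fun a => (e (Sum.inr a)).2, ?_, Set.infinite_range_of_injective hl,
    Set.infinite_range_of_injective hr⟩
  rw [Set.disjoint_left]
  rintro _ ⟨a, rfl⟩ ⟨b, h⟩
  simpa using e.injective (Subtype.ext h)

/-- The permutations supported in a fixed infinite and coinfinite set generate, together with
finitely many permutations, the whole symmetric group. -/
theorem exists_finite_forall_eq_top {A : Set Ω} (hA : A.Infinite) (hA' : Aᶜ.Infinite) :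
    ∃ C : Set (Perm Ω), C.Finite ∧ ∀ K : Subgroup (Perm Ω), C ⊆ K →
      (∀ f : Perm Ω, (∀ x ∉ A, f x = x) → f ∈ K) → K = ⊤ := by
  obtain ⟨P, hPA, R, hRA, hPR, hP, hR⟩ := exists_disjoint_infinite_subsets hA
  -- `x` carries `A` onto the complement of `B`
  have move : ∀ B : Set Ω, B.Infinite → Bᶜ.Infinite → ∃ x : Perm Ω, ∀ y, x y ∉ B ↔ y ∈ A := by
    intro B hB hB'
    obtain ⟨f, hf⟩ := exists_bijOn_of_infinite hA hB'
    obtain ⟨x, hx, -⟩ := exists_perm_eqOn hf (Set.subset_univ _) (Set.subset_univ _)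
      (by rwa [← Set.compl_eq_univ_sdiff]) (by rwa [← Set.compl_eq_univ_sdiff, compl_compl])
    refine ⟨x, fun y => ⟨fun h => ?_, fun h => ?_⟩⟩
    · obtain ⟨z, hz, hzy⟩ := hf.surjOn h
      rwa [← x.injective (hzy ▸ hx hz : x z = x y)]
    · rw [hx h]; exact hf.mapsTo h
  obtain ⟨x, hx⟩ := move P hP (hR.mono fun y hy h => Set.disjoint_left.1 hPR h hy)
  obtain ⟨z, hz⟩ := move R hR (hP.mono fun y hy h => Set.disjoint_left.1 hPR hy h)
  refine ⟨{x, z}, by simp, fun K hC hK => ?_⟩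
  have conj : ∀ w ∈ K, ∀ B : Set Ω, (∀ y, w y ∉ B ↔ y ∈ A) → ∀ f : Perm Ω,
      (∀ y ∈ B, f y = y) → f ∈ K := by
    intro w hw B hwB f hf
    have : w⁻¹ * f * w ∈ K := hK _ fun y hy => by
      have : w y ∈ B := not_not.1 (mt (hwB y).1 hy)
      simp [hf _ this]
    have := K.mul_mem (K.mul_mem hw this) (K.inv_mem hw)
    simpa [mul_assoc] using this
  have hKP := conj x (hC (by simp)) P hx
  have hKR := conj z (hC (by simp)) R hz
  refine (Subgroup.eq_top_iff' K).2 fun g => ?_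
  -- Since `R ⊆ A`, the sets `A` and `Rᶜ` cover everything, so `g` sends infinitely many points of
  -- `P` into one of them.
  obtain ⟨E, hPE, hEK, hE⟩ : ∃ E : Set Ω, P ⊆ E ∧ (∀ f : Perm Ω, (∀ y ∉ E, f y = y) → f ∈ K) ∧
      (P ∩ g ⁻¹' E).Infinite := by
    have : (P ∩ g ⁻¹' A ∪ P ∩ g ⁻¹' Rᶜ).Infinite := by
      rw [← Set.inter_union_distrib_left, ← Set.preimage_union]
      refine hP.mono fun y hy => ⟨hy, ?_⟩
      by_cases h : g y ∈ R
      · exact Or.inl (hRA h)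
      · exact Or.inr h
    rcases Set.infinite_union.1 this with h | h
    · exact ⟨A, hPA, hK, h⟩
    · exact ⟨Rᶜ, fun y hy h => Set.disjoint_left.1 hPR hy h,
        fun f hf => hKR f fun y hy => hf y (not_not.2 hy), h⟩
  obtain ⟨Q, hQ, Q', hQ', hQQ, hQi, hQi'⟩ := exists_disjoint_infinite_subsets hE
  have hQd : (P \ Q).Infinite :=
    hQi'.mono fun y hy => ⟨(hQ' hy).1, fun h => Set.disjoint_left.1 hQQ h hy⟩
  -- With `k` equal to `g` on `Q`, the permutation `k⁻¹ * g` fixes `Q` pointwise. Conjugating by an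
  -- `l` that carries `Q` onto `P` makes it fix `P`, hence lie in `K`. The reserved set `Q'` leaves
  -- room to extend `k`.
  obtain ⟨k, hkg, hkE⟩ := exists_perm_eqOn (g.injective.injOn.bijOn_image (s := Q))
    (fun y hy => hPE (hQ hy).1) (Set.image_subset_iff.2 fun y hy => (hQ hy).2)
    (hQd.mono (Set.sdiff_subset_sdiff_left hPE))
    ((hQi'.image g.injective.injOn).mono (by
      rintro _ ⟨y, hy, rfl⟩
      refine ⟨(hQ' hy).2, ?_⟩
      rintro ⟨y', hy', h⟩
      exact Set.disjoint_left.1 hQQ hy' (g.injective h ▸ hy)))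
  obtain ⟨f, hf⟩ := exists_bijOn_of_infinite hQi hP
  obtain ⟨l, hl, hlA⟩ := exists_perm_eqOn hf (fun y hy => hPA (hQ hy).1) hPA
    (hQd.mono (Set.sdiff_subset_sdiff_left hPA))
    (hR.mono fun y hy => ⟨hRA hy, fun h => Set.disjoint_left.1 hPR h hy⟩)
  have hkK := hEK k hkE
  have hlK := hK l hlA
  have : l * (k⁻¹ * g) * l⁻¹ ∈ K := hKP _ fun y hy => by
    obtain ⟨q, hq, rfl⟩ := hf.surjOn hy
    rw [← hl hq]
    simp [← hkg hq]
  have := K.mul_mem hkK (K.mul_mem (K.mul_mem (K.inv_mem hlK) this) hlK)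
  simpa [mul_assoc] using this

end Generation

/-! ### Factoring a permutation into two infinitely often predicted ones -/

section Decomposition

theorem exists_perm_extend_of_injOn {S : Set ℕ} {M : ℕ} {f : ℕ → ℕ} (hS : ∀ m ∈ S, m < M)
    (hfM : ∀ m ∈ S, f m < M) (hf : S.InjOn f) :
    ∃ τ : Perm ℕ, (∀ m ∈ S, τ m = f m) ∧ ∀ m, M ≤ m → τ m = m := by
  classical
  obtain ⟨e, he⟩ := Set.MapsTo.exists_equiv_extend_of_card_eq (α := Finset.range M)
    (t := Finset.range M) (by simp) (s := {m | (m : ℕ) ∈ S}) (f := fun m => f m)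
    (fun m hm => by simpa using hfM _ hm) (fun a ha b hb h => Subtype.ext (hf ha hb h))
  refine ⟨Perm.ofSubtype (p := fun m => m ∈ Finset.range M) e, fun m hm => ?_, fun m hm => ?_⟩
  · have hm' : m ∈ Finset.range M := Finset.mem_range.2 (hS m hm)
    rw [Perm.ofSubtype_apply_of_mem (p := fun m => m ∈ Finset.range M) e hm']
    exact he ⟨m, hm'⟩ hm
  · exact Perm.ofSubtype_apply_of_not_mem (p := fun m => m ∈ Finset.range M) e (by simpa using hm)

theorem lt_iff_lt_of_fixes {π : Perm ℕ} {M : ℕ} (h : ∀ m, M ≤ m → π m = m) {y : ℕ} (hy : M ≤ y)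
    (m : ℕ) : π m < y ↔ m < y := by
  constructor
  · intro hm
    by_contra hlt
    rw [h m (hy.trans (not_lt.1 hlt))] at hm
    exact hlt hm
  · intro hm
    by_contra hlt
    have := π.injective (h (π m) (hy.trans (not_lt.1 hlt)))
    omega

/-- `s` agrees infinitely often along `X` with the prediction `t y` of `s` on `[0, y)`, where `t y`
preserves `[0, y)`. -/
def predictionSet (X : Set ℕ) (t : ℕ → Perm ℕ) (s : Perm ℕ) : Set ℕ :=
  {y | y ∈ X ∧ (∀ m < y, t y m = s m) ∧ ∀ m, t y m < y ↔ m < y}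

/-- The sequence `t` takes every finitely supported permutation as a value, infinitely often
on `X`. -/
def ListsFinitary (X : Set ℕ) (t : ℕ → Perm ℕ) : Prop :=
  ∀ (π : Perm ℕ) (M : ℕ), (∀ m, M ≤ m → π m = m) → ∀ N, ∃ y ∈ X, N ≤ y ∧ t y = π

theorem exists_listsFinitary {X : Set ℕ} (hX : X.Infinite) : ∃ t, ListsFinitary X t := by
  classical
  let F := Σ M : ℕ, Perm (Finset.range M)
  have : Nonempty F := ⟨⟨0, 1⟩⟩
  obtain ⟨f, hf⟩ := exists_surjective_nat F
  let dec : F → Perm ℕ := fun a => Perm.ofSubtype (p := fun m => m ∈ Finset.range a.1) a.2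
  -- The position of `y` in `X` is read as a pair: the first entry names the permutation, and the
  -- free second entry makes each name recur.
  refine ⟨fun y => dec (f (Nat.unpair (Nat.count (· ∈ X) y)).1), fun π M hπ N => ?_⟩
  obtain ⟨a, ha⟩ := hf ⟨M, π.subtypePerm (p := fun m => m ∈ Finset.range M)
    fun m => by simpa using lt_iff_lt_of_fixes hπ le_rfl m⟩
  refine ⟨Nat.nth (· ∈ X) (Nat.pair a N), Nat.nth_mem_of_infinite hX _,
    (Nat.right_le_pair a N).trans (Nat.nth_strictMono hX).le_apply, ?_⟩
  simp only [Nat.count_nth_of_infinite (p := (· ∈ X)) hX, Nat.unpair_pair, ha, dec]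
  refine Perm.ofSubtype_subtypePerm (p := fun m => m ∈ Finset.range M) _ fun m hm => ?_
  by_contra h
  exact hm (hπ m (by simpa using h))

/-- Each `π k` preserves `[0, N k)`, so the inverses cohere as well and their limit inverts the
limit of the `π k`. -/
theorem exists_perm_of_coherent (π : ℕ → Perm ℕ) (N : ℕ → ℕ) (hN : ∀ k, k ≤ N k)
    (hfix : ∀ k m, N k ≤ m → π k m = m) (hπ : ∀ k, ∀ m < N k, π (k + 1) m = π k m)
    (hmono : ∀ k, N k ≤ N (k + 1)) : ∃ s : Perm ℕ, ∀ k, ∀ m < N k, s m = π k m := by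
  have hNmono : Monotone N := monotone_nat_of_le_succ hmono
  have coh : ∀ j k, j ≤ k → ∀ m < N j, π k m = π j m := by
    intro j k hjk m hm
    induction k, hjk using Nat.le_induction with
    | base => rfl
    | succ k hjk ih => rw [hπ k m (hm.trans_le (hNmono hjk)), ih]
  have coh' : ∀ j k, ∀ m < N j, m < N k → π k m = π j m := by
    intro j k m hj hk
    rcases le_total j k with h | h
    · exact coh j k h m hj
    · exact (coh k j h m hk).symm
  have hlt : ∀ k m, π k m < N k ↔ m < N k := fun k m => lt_iff_lt_of_fixes (hfix k) le_rfl m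
  have hlt' : ∀ k m, m < N k → (π k)⁻¹ m < N k := fun k m h => by
    rw [← hlt k]; simpa using h
  have cohi : ∀ j k, ∀ m < N j, m < N k → (π k)⁻¹ m = (π j)⁻¹ m := by
    intro j k m hj hk
    rcases le_total j k with h | h
    · rw [Perm.inv_eq_iff_eq, coh j k h _ (hlt' j m hj)]; simp
    · rw [eq_comm, Perm.inv_eq_iff_eq, coh k j h _ (hlt' k m hk)]; simp
  have hself : ∀ m, m < N (m + 1) := fun m => hN (m + 1)
  refine ⟨⟨fun m => π (m + 1) m, fun m => (π (m + 1))⁻¹ m, fun m => ?_, fun m => ?_⟩,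
    fun k m hm => (coh' k (m + 1) m hm (hself m) :)⟩
  · have h := (hlt (m + 1) m).2 (hself m)
    change (π (π (m + 1) m + 1))⁻¹ (π (m + 1) m) = m
    rw [cohi (m + 1) _ _ h (hself _)]; simp
  · have h := hlt' (m + 1) m (hself m)
    change π ((π (m + 1))⁻¹ m + 1) ((π (m + 1))⁻¹ m) = m
    rw [coh' (m + 1) _ _ h (hself _)]; simp

/-- One step of the construction in `exists_eq_mul_of_listsFinitary`. -/
theorem exists_extension_step {X : Set ℕ} {t : ℕ → Perm ℕ} (ht : ListsFinitary X t) (g π : Perm ℕ)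
    (N k : ℕ) (hπ : ∀ m, N ≤ m → π m = m) :
    ∃ (π' : Perm ℕ) (N' : ℕ), (∀ m, N' ≤ m → π' m = m) ∧ (∀ m < N, π' m = π m) ∧ N ≤ N' ∧
      k ≤ N' ∧
      (∃ y ∈ X, k ≤ y ∧ y ≤ N' ∧ (∀ m < y, t y m = π' m) ∧ ∀ m, t y m < y ↔ m < y) ∧
      ∃ y ∈ X, k ≤ y ∧ y ≤ N' ∧ (∀ m < y, π' (t y m) = g m) ∧ ∀ m, t y m < y ↔ m < y := by
  -- The current approximation is itself the guess at `y₁`. The extension `ρ` below keeps it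
  -- unchanged on `[0, y₁)`.
  obtain ⟨y₁, hy₁X, hy₁, hty₁⟩ := ht π N hπ (max N k)
  have hπy₁ := lt_iff_lt_of_fixes hπ ((le_max_left N k).trans hy₁)
  obtain ⟨M, hM⟩ : ∃ M, ∀ m < y₁, g⁻¹ m < M := by
    refine ⟨(Finset.range y₁).sup (fun m => g⁻¹ m) + 1, fun m hm => Nat.lt_succ_of_le ?_⟩
    exact Finset.le_sup (f := fun m => g⁻¹ m) (Finset.mem_range.2 hm)
  have hgM : ∀ m, g m < y₁ → m < max M y₁ := fun m hm =>
    lt_max_of_lt_left (by simpa using hM _ hm)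
  -- `τ` is the guess for the second factor `ρ⁻¹ * g`: it is forced where `g m < y₁` and arbitrary
  -- elsewhere.
  obtain ⟨τ, hτ, hτM⟩ := exists_perm_extend_of_injOn (S := {m | g m < y₁}) (M := max M y₁)
    (f := fun m => π⁻¹ (g m)) hgM (fun m hm => lt_max_of_lt_right (by
      rw [← hπy₁]; simpa using! hm)) (fun a _ b _ h => g.injective (π⁻¹.injective h))
  obtain ⟨y₂, hy₂X, hy₂, hty₂⟩ := ht τ _ hτM (max (max M y₁) k)
  have hτy₂ := lt_iff_lt_of_fixes hτM ((le_max_left _ k).trans hy₂)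
  obtain ⟨N', hN'⟩ : ∃ N', ∀ m < y₂, g m < N' := by
    refine ⟨(Finset.range y₂).sup g + 1, fun m hm => Nat.lt_succ_of_le ?_⟩
    exact Finset.le_sup (f := g) (Finset.mem_range.2 hm)
  -- Setting `ρ = g * τ⁻¹` on `[0, y₂)` makes the guess `τ` at `y₂` correct.
  obtain ⟨ρ, hρ, hρN⟩ := exists_perm_extend_of_injOn (S := {m | m < y₂}) (M := max N' y₂)
    (f := fun m => g (τ⁻¹ m)) (fun m hm => lt_max_of_lt_right hm)
    (fun m hm => lt_max_of_lt_left (hN' _ (by rw [← hτy₂]; simpa using! hm)))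
    (fun a _ b _ h => τ⁻¹.injective (g.injective h))
  have hy₁₂ : y₁ ≤ y₂ := (le_max_right M y₁).trans ((le_max_left _ k).trans hy₂)
  have hρπ : ∀ m < y₁, ρ m = π m := by
    intro a ha
    have h1 : g (g⁻¹ (π a)) < y₁ := by simpa using (hπy₁ a).2 ha
    have h2 : τ (g⁻¹ (π a)) = a := by simpa using! hτ _ h1
    rw [hρ a (ha.trans_le hy₁₂), ← Perm.eq_inv_iff_eq.2 h2]
    simp
  refine ⟨ρ, max N' y₂, hρN, fun m hm => hρπ m ?_, ?_, ?_, ⟨y₁, hy₁X, ?_, ?_, fun m hm => ?_, ?_⟩,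
    ⟨y₂, hy₂X, ?_, le_max_right _ _, fun m hm => ?_, ?_⟩⟩
  · exact hm.trans_le ((le_max_left _ _).trans hy₁)
  · exact ((le_max_left _ _).trans hy₁).trans (hy₁₂.trans (le_max_right _ _))
  · exact ((le_max_right _ _).trans hy₁).trans (hy₁₂.trans (le_max_right _ _))
  · exact (le_max_right _ _).trans hy₁
  · exact hy₁₂.trans (le_max_right _ _)
  · rw [hty₁, hρπ m hm]
  · rw [hty₁]; exact hπy₁
  · exact (le_max_right _ _).trans hy₂
  · rw [hty₂, hρ _ ((hτy₂ m).2 hm)]; simp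
  · rw [hty₂]; exact hτy₂

/-- Finite approximations to `s₁` are extended so that each step secures one new correct guess for
`s₁` and one for `s₁⁻¹ * g`. -/
theorem exists_eq_mul_of_listsFinitary {X : Set ℕ} {t : ℕ → Perm ℕ} (ht : ListsFinitary X t)
    (g : Perm ℕ) : ∃ s₁ s₂ : Perm ℕ, g = s₁ * s₂ ∧ (predictionSet X t s₁).Infinite ∧
      (predictionSet X t s₂).Infinite := by
  let State := {q : Perm ℕ × ℕ // ∀ m, q.2 ≤ m → q.1 m = m}
  have hstep : ∀ (k : ℕ) (q : State), ∃ q' : State, (∀ m < q.1.2, q'.1.1 m = q.1.1 m) ∧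
      q.1.2 ≤ q'.1.2 ∧ k ≤ q'.1.2 ∧
      (∃ y ∈ X, k ≤ y ∧ y ≤ q'.1.2 ∧ (∀ m < y, t y m = q'.1.1 m) ∧ ∀ m, t y m < y ↔ m < y) ∧
      ∃ y ∈ X, k ≤ y ∧ y ≤ q'.1.2 ∧ (∀ m < y, q'.1.1 (t y m) = g m) ∧ ∀ m, t y m < y ↔ m < y := by
    intro k q
    obtain ⟨π', N', h, h'⟩ := exists_extension_step ht g q.1.1 q.1.2 k q.2
    exact ⟨⟨(π', N'), h⟩, h'⟩
  choose next hnext using hstep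
  let Q : ℕ → State := fun k => Nat.rec ⟨(1, 0), fun _ _ => rfl⟩ (fun k q => next (k + 1) q) k
  have hQ : ∀ k, Q (k + 1) = next (k + 1) (Q k) := fun _ => rfl
  obtain ⟨s, hs⟩ := exists_perm_of_coherent (fun k => (Q k).1.1) (fun k => (Q k).1.2)
    (fun k => by cases k with
      | zero => exact Nat.zero_le _
      | succ k => exact (hnext (k + 1) (Q k)).2.2.1)
    (fun k => (Q k).2) (fun k => (hnext (k + 1) (Q k)).1) (fun k => (hnext (k + 1) (Q k)).2.1)
  refine ⟨s, s⁻¹ * g, by simp, Set.infinite_of_forall_exists_gt fun k => ?_,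
    Set.infinite_of_forall_exists_gt fun k => ?_⟩
  · obtain ⟨y, hyX, hky, hyN, hty, hy⟩ := (hnext (k + 1) (Q k)).2.2.2.1
    refine ⟨y, ⟨hyX, fun m hm => ?_, hy⟩, hky⟩
    rw [hty m hm, hs (k + 1) m (hm.trans_le hyN), hQ]
  · obtain ⟨y, hyX, hky, hyN, hty, hy⟩ := (hnext (k + 1) (Q k)).2.2.2.2
    refine ⟨y, ⟨hyX, fun m hm => ?_, hy⟩, hky⟩
    rw [Perm.mul_apply, ← hty m hm, Perm.eq_inv_iff_eq,
      hs (k + 1) _ (((hy m).2 hm).trans_le hyN), hQ]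

end Decomposition

end CofSpectrum
-- Coding infinite sets by permutations
namespace CofSpectrum
open Equiv

/-- The set on which the coding permutations act: the summand `ℤ × ℕ` consists of copies of `ℕ`,
and above each node `y : ℕ` there is one further copy of `ℤ × ℕ`. -/
abbrev CodeSpace : Type := (ℤ × ℕ) ⊕ (ℕ × ℤ × ℕ)

/-- Exchanges each point `(i, m)` of the base with its copy above the node `n m`. -/
def nodeSwap (n : ℕ → ℕ) : Perm CodeSpace :=
  Function.Involutive.toPerm
    (fun
      | Sum.inl (i, m) => Sum.inr (n m, i, m)
      | Sum.inr (y, i, m) => if y = n m then Sum.inl (i, m) else Sum.inr (y, i, m))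
    (by
      rintro (⟨i, m⟩ | ⟨y, i, m⟩)
      · simp
      · by_cases h : y = n m <;> simp [h])

@[simp] theorem nodeSwap_inl (n : ℕ → ℕ) (i : ℤ) (m : ℕ) :
    nodeSwap n (Sum.inl (i, m)) = Sum.inr (n m, i, m) := rfl

@[simp] theorem nodeSwap_inr (n : ℕ → ℕ) (y : ℕ) (i : ℤ) (m : ℕ) :
    nodeSwap n (Sum.inr (y, i, m)) =
      if y = n m then Sum.inl (i, m) else Sum.inr (y, i, m) := rfl

theorem nodeSwap_nodeSwap_inr {n n' : ℕ → ℕ} {m : ℕ} (h : n m = n' m) (y : ℕ) (i : ℤ) :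
    nodeSwap n (nodeSwap n' (Sum.inr (y, i, m))) = Sum.inr (y, i, m) := by
  by_cases hy : y = n' m <;> simp [hy, h]

/-- Acts above the node `y` by `t y` on the copies of `ℕ` with nonnegative index. -/
def nodePerm (t : ℕ → Perm ℕ) : Perm CodeSpace :=
  Equiv.sumCongr 1 (Equiv.prodShear 1 fun y => Equiv.prodShear 1 fun i : ℤ =>
    if 0 ≤ i then t y else 1)

@[simp] theorem nodePerm_inl (t : ℕ → Perm ℕ) (a : ℤ × ℕ) :
    nodePerm t (Sum.inl a) = Sum.inl a := rfl

@[simp] theorem nodePerm_inr (t : ℕ → Perm ℕ) (y : ℕ) (i : ℤ) (m : ℕ) :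
    nodePerm t (Sum.inr (y, i, m)) = Sum.inr (y, i, (if 0 ≤ i then t y else 1) m) := rfl

/-- The shift of the base. -/
def baseShift : Perm CodeSpace :=
  Equiv.sumCongr (Equiv.prodCongr (Equiv.addRight 1) 1) 1

@[simp] theorem baseShift_inl (i : ℤ) (m : ℕ) :
    baseShift (Sum.inl (i, m)) = Sum.inl (i + 1, m) := rfl

@[simp] theorem baseShift_inr (a : ℕ × ℤ × ℕ) : baseShift (Sum.inr a) = Sum.inr a := rfl

/-- Acts by `s` on the zeroth copy of `ℕ` in the base. -/
def basePerm (s : Perm ℕ) : Perm CodeSpace :=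
  Equiv.sumCongr (Equiv.prodShear 1 fun i : ℤ => if i = 0 then s else 1) 1

@[simp] theorem basePerm_inl (s : Perm ℕ) (i : ℤ) (m : ℕ) :
    basePerm s (Sum.inl (i, m)) = Sum.inl (i, (if i = 0 then s else 1) m) := rfl

@[simp] theorem basePerm_inr (s : Perm ℕ) (a : ℕ × ℤ × ℕ) :
    basePerm s (Sum.inr a) = Sum.inr a := rfl

theorem basePerm_mul (s t : Perm ℕ) : basePerm (s * t) = basePerm s * basePerm t := by
  ext1 x
  rcases x with ⟨i, m⟩ | a
  · by_cases h : i = 0 <;> simp [h]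
  · simp

/-- If `n` selects nodes `y` at which `t y` predicts `s` correctly, then `s` can be recovered from
the coding permutation `nodeSwap n`. -/
theorem basePerm_eq_commutator {n : ℕ → ℕ} {t : ℕ → Perm ℕ} {s : Perm ℕ}
    (hs : ∀ m, t (n m) m = s m) (hn : ∀ y m, n (t y m) = y ↔ n m = y) :
    basePerm s = (nodeSwap n * nodePerm t * nodeSwap n) * baseShift *
      (nodeSwap n * nodePerm t * nodeSwap n)⁻¹ * baseShift⁻¹ := by
  set V := nodeSwap n * nodePerm t * nodeSwap n with hV
  -- On the base, `V` is `s` on all copies of index at least 0. Its conjugate by the shift is `s` on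
  -- those of index at least 1, so the commutator leaves only copy 0. Above the nodes the shift is
  -- trivial and everything cancels.
  have hVl : ∀ i m, V (Sum.inl (i, m)) = Sum.inl (i, (if 0 ≤ i then s else 1) m) := by
    intro i m
    by_cases hi : 0 ≤ i
    · have := (hn (n m) m).2 rfl
      rw [hs] at this
      simp [hV, hi, hs, this]
    · simp [hV, hi]
  have hVr : ∀ a, ∃ b, V (Sum.inr a) = Sum.inr b := by
    rintro ⟨y, i, m⟩
    by_cases hy : y = n m
    · exact ⟨(y, i, m), by simp [hV, hy]⟩
    · by_cases hi : 0 ≤ i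
      · have : y ≠ n (t y m) := fun h => hy ((hn y m).1 h.symm).symm
        exact ⟨(y, i, t y m), by simp [hV, hy, hi, this]⟩
      · exact ⟨(y, i, m), by simp [hV, hy, hi]⟩
  rw [eq_mul_inv_iff_mul_eq, eq_mul_inv_iff_mul_eq]
  ext1 x
  rcases x with ⟨i, m⟩ | a
  · simp only [Perm.mul_apply, hVl, baseShift_inl, basePerm_inl]
    rcases lt_trichotomy i (-1) with h | rfl | h
    · have h1 : ¬ 0 ≤ i := by omega
      have h2 : ¬ 0 ≤ i + 1 := by omega
      have h3 : i + 1 ≠ 0 := by omega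
      simp [h1, h2, h3]
    · simp
    · have h1 : 0 ≤ i := by omega
      have h2 : 0 ≤ i + 1 := by omega
      have h3 : i + 1 ≠ 0 := by omega
      simp [h1, h2, h3]
  · obtain ⟨b, hb⟩ := hVr a
    simp [hb]

/-- The least element of `Y` above `m`. -/
noncomputable def nextElt (Y : Set ℕ) (m : ℕ) : ℕ := sInf {y | y ∈ Y ∧ m < y}

theorem nextElt_mem {Y : Set ℕ} (hY : Y.Infinite) (m : ℕ) :
    nextElt Y m ∈ Y ∧ m < nextElt Y m :=
  Nat.sInf_mem (s := {y | y ∈ Y ∧ m < y}) (hY.exists_gt m)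

theorem nextElt_congr {Y : Set ℕ} {a b : ℕ} (h : ∀ y ∈ Y, a < y ↔ b < y) :
    nextElt Y a = nextElt Y b := by
  have : {y | y ∈ Y ∧ a < y} = {y | y ∈ Y ∧ b < y} := by
    ext y
    exact and_congr_right (h y)
  rw [nextElt, nextElt, this]

theorem nextElt_inter_eventually {Y X : Set ℕ} (h : (Y \ X).Finite) :
    ∃ M, ∀ m, M ≤ m → nextElt Y m = nextElt (Y ∩ X) m := by
  obtain ⟨M, hM⟩ := h.bddAbove
  refine ⟨M, fun m hm => ?_⟩
  have : {y | y ∈ Y ∧ m < y} = {y | y ∈ Y ∩ X ∧ m < y} := by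
    ext y
    refine ⟨fun hy => ⟨⟨hy.1, ?_⟩, hy.2⟩, fun hy => ⟨hy.1.1, hy.2⟩⟩
    by_contra hyX
    exact absurd (hM ⟨hy.1, hyX⟩) (not_le.2 (hm.trans_lt hy.2))
  rw [nextElt, nextElt, this]

/-- At each `y ∈ Y` the guess is correct below `y` and preserves `[0, y)`, so `s` does too. Thus `s`
preserves the fibres of `nextElt Y`, as the commutator identity requires. -/
theorem basePerm_mem_of_nodeSwap_mem {K : Subgroup (Perm CodeSpace)} {X Y : Set ℕ}
    {t : ℕ → Perm ℕ} {s : Perm ℕ} (hY : Y.Infinite) (hYX : Y ⊆ predictionSet X t s)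
    (ht : nodePerm t ∈ K) (hσ : baseShift ∈ K) (hn : nodeSwap (nextElt Y) ∈ K) :
    basePerm s ∈ K := by
  have hsY : ∀ y ∈ Y, ∀ m, m < y ↔ s m < y := by
    intro y hy m
    obtain ⟨-, hts, hty⟩ := hYX hy
    constructor
    · intro hm
      rw [← hts m hm]
      exact (hty m).2 hm
    · intro hm
      have hlt : (t y)⁻¹ (s m) < y := by rw [← hty]; simpa using hm
      have heq : (t y)⁻¹ (s m) = m := s.injective ((hts _ hlt).symm.trans (by simp))
      rwa [heq] at hlt
  have hnext : ∀ m, nextElt Y (s m) = nextElt Y m := fun m =>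
    (nextElt_congr fun y hy => hsY y hy m).symm
  rw [basePerm_eq_commutator (n := nextElt Y) (t := t) (s := s)
    (fun m => (hYX (nextElt_mem hY m).1).2.1 m (nextElt_mem hY m).2) ?_]
  · have hV := K.mul_mem (K.mul_mem hn ht) hn
    exact K.mul_mem (K.mul_mem (K.mul_mem hV hσ) (K.inv_mem hV)) (K.inv_mem hσ)
  · intro y m
    by_cases hy : y ∈ Y
    · obtain ⟨-, hts, hty⟩ := hYX hy
      by_cases hm : m < y
      · rw [hts m hm, hnext]
      · have h1 := (nextElt_mem hY m).2
        have h2 := (nextElt_mem hY (t y m)).2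
        have h3 := mt (hty m).1 hm
        omega
    · exact ⟨fun h => absurd (h ▸ (nextElt_mem hY _).1) hy,
        fun h => absurd (h ▸ (nextElt_mem hY _).1) hy⟩

/-- The quotients of coding permutations for eventually equal functions. -/
def nodeSwapQuotients : Set (Perm CodeSpace) :=
  {g | ∃ (n n' : ℕ → ℕ) (M : ℕ), (∀ m, M ≤ m → n m = n' m) ∧ g = nodeSwap n * nodeSwap n'}

/-- Over any `m` with `n m = n' m` the product is the identity, so it depends only on the values
below `M`. -/
theorem countable_nodeSwapQuotients : nodeSwapQuotients.Countable := by
  let F : List ℕ → ℕ → ℕ := fun l m => l.getD m 0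
  refine (Set.countable_range fun p : List ℕ × List ℕ =>
    nodeSwap (F p.1) * nodeSwap (F p.2)).mono ?_
  rintro _ ⟨n, n', M, h, rfl⟩
  have hF : ∀ f : ℕ → ℕ, ∀ m, F ((List.range M).map f) m = if m < M then f m else 0 := by
    intro f m
    by_cases hm : m < M <;> simp [F, List.getD, hm]
  refine ⟨((List.range M).map n, (List.range M).map n'), ?_⟩
  ext1 x
  rcases x with ⟨i, m⟩ | ⟨y, i, m⟩
  · by_cases hm : m < M
    · simp [hF, hm]
    · simp [hF, hm, h m (not_lt.1 hm)]
  · by_cases hm : m < M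
    · by_cases hy : y = n' m <;> simp [hF, hm, hy]
    · rw [Perm.mul_apply, Perm.mul_apply, nodeSwap_nodeSwap_inr (h m (not_lt.1 hm)),
        nodeSwap_nodeSwap_inr (by simp [hF, hm])]

/-- The subgroup `G` cannot be enlarged to the whole group by adding countably many elements. -/
def HasUncountableCodim {Γ : Type*} [Group Γ] (G : Subgroup Γ) : Prop :=
  ∀ C : Set Γ, C.Countable → G ⊔ Subgroup.closure C ≠ ⊤

theorem exists_dense_nodeSwap_notMem {G : Subgroup (Perm CodeSpace)} (hG : HasUncountableCodim G)
    {X : Set ℕ} (hX : X.Infinite) :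
    ∃ Y ⊆ X, Y.Infinite ∧ ∀ Z ⊆ Y, Z.Infinite → nodeSwap (nextElt Z) ∉ G := by
  obtain ⟨t, ht⟩ := exists_listsFinitary hX
  let A : Set CodeSpace := Set.range fun m : ℕ => Sum.inl ((0 : ℤ), m)
  have hA : A.Infinite := Set.infinite_range_of_injective fun a b h => by simpa using h
  have hA' : Aᶜ.Infinite := by
    refine (Set.infinite_range_of_injective
      (f := fun m : ℕ => (Sum.inl ((1 : ℤ), m) : CodeSpace)) fun a b h => by simpa using h).mono ?_
    rintro _ ⟨m, rfl⟩ ⟨k, hk⟩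
    simp at hk
  obtain ⟨C, hC, htop⟩ := exists_finite_forall_eq_top hA hA'
  set K := G ⊔ Subgroup.closure (C ∪ {nodePerm t, baseShift}) with hK
  have hCK : C ∪ {nodePerm t, baseShift} ⊆ K :=
    Subgroup.subset_closure.trans (le_sup_right (a := G) : _ ≤ K)
  obtain ⟨g, hg⟩ : ∃ g, basePerm g ∉ K := by
    by_contra! hall
    refine hG (C ∪ {nodePerm t, baseShift}) (hC.union (by simp)).countable
      (htop K (Set.subset_union_left.trans hCK) fun f hf => ?_)
    have hfA : ∀ x, f x ∈ A ↔ x ∈ A := by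
      intro x
      constructor
      · intro hx
        by_contra hxA
        exact hxA (by rwa [hf x hxA] at hx)
      · intro hx
        by_contra hxA
        exact hxA ((f.injective (hf _ hxA)).symm ▸ hx)
    let e : ℕ ≃ {x // x ∈ A} := Equiv.ofInjective _ fun a b h => by simpa using h
    have hfe : f = basePerm (e.symm.permCongr (f.subtypePerm hfA)) := by
      ext1 x
      by_cases hx : x ∈ A
      · obtain ⟨m, rfl⟩ := hx
        have : e (e.symm (f.subtypePerm hfA (e m))) = f.subtypePerm hfA (e m) := by simp
        exact (congrArg Subtype.val this).symm
      · rw [hf x hx]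
        rcases x with ⟨i, m⟩ | a
        · have : i ≠ 0 := fun h => hx ⟨m, by rw [h]⟩
          simp [this]
        · simp
    rw [hfe]
    exact hall _
  -- If both predicted factors of `g` were coded in `K`, so would be `g`.
  obtain ⟨s, hs, hsK⟩ : ∃ s, (predictionSet X t s).Infinite ∧ basePerm s ∉ K := by
    obtain ⟨s₁, s₂, rfl, h₁, h₂⟩ := exists_eq_mul_of_listsFinitary ht g
    by_cases h : basePerm s₁ ∈ K
    · refine ⟨s₂, h₂, fun h' => hg ?_⟩
      rw [basePerm_mul]
      exact K.mul_mem h h'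
    · exact ⟨s₁, h₁, h⟩
  refine ⟨predictionSet X t s, fun y hy => hy.1, hs, fun Z hZ hZi hZG => hsK ?_⟩
  exact basePerm_mem_of_nodeSwap_mem hZi hZ (hCK (by simp)) (hCK (by simp))
    ((le_sup_left : G ≤ K) hZG)

theorem HasUncountableCodim.sup_closure {Γ : Type*} [Group Γ] {G : Subgroup Γ}
    (hG : HasUncountableCodim G) {C : Set Γ} (hC : C.Countable) :
    HasUncountableCodim (G ⊔ Subgroup.closure C) := by
  intro C' hC'
  rw [sup_assoc, ← Subgroup.closure_union]
  exact hG _ (hC.union hC')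

theorem HasUncountableCodim.map_mulEquiv {Γ Δ : Type*} [Group Γ] [Group Δ] {G : Subgroup Γ}
    (hG : HasUncountableCodim G) (e : Γ ≃* Δ) : HasUncountableCodim (G.map e.toMonoidHom) := by
  intro C hC h
  refine hG (e.symm '' C) (hC.image _) ?_
  have := congrArg (Subgroup.map e.symm.toMonoidHom) h
  rw [Subgroup.map_sup, Subgroup.map_map, MonoidHom.map_closure,
    Subgroup.map_top_of_surjective _ e.symm.surjective] at this
  have hid : e.symm.toMonoidHom.comp e.toMonoidHom = MonoidHom.id Γ := by ext x; simp
  rw [hid, Subgroup.map_id] at this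
  exact this

open Cardinal in
/-- Under `MA κ`, the group `Sym(ℕ)` is not covered by `κ` many subgroups of uncountable
codimension. -/
theorem MA.exists_forall_notMem {κ : Cardinal.{0}} (hMA : MA κ) (hκ : ℵ₀ ≤ κ) {I : Type}
    [LinearOrder I] [WellFoundedLT I] (hI : #I ≤ κ) (G : I → Subgroup (Perm ℕ))
    (hG : ∀ i, HasUncountableCodim (G i)) : ∃ u, ∀ i, u ∉ G i := by
  obtain ⟨e⟩ := nonempty_equiv_of_countable (α := ℕ) (β := CodeSpace)
  let E : Perm ℕ ≃* Perm CodeSpace := e.permCongrHom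
  -- Adjoining the countably many quotients makes membership of a code insensitive to finite changes
  -- of the coded set.
  let H : I → Subgroup (Perm CodeSpace) := fun i =>
    (G i).map E.toMonoidHom ⊔ Subgroup.closure nodeSwapQuotients
  have hH : ∀ i, HasUncountableCodim (H i) := fun i =>
    ((hG i).map_mulEquiv E).sup_closure countable_nodeSwapQuotients
  obtain ⟨X, hX, hXH⟩ := hMA.exists_mem_forall_of_dense hκ hI
    (fun i => {X | ∀ Z ⊆ X, Z.Infinite → nodeSwap (nextElt Z) ∉ H i})
    (fun i X hX Y _ hYX Z hZY hZ hmem => by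
      have hfin : (Z \ X).Finite := hYX.subset (Set.sdiff_subset_sdiff_left hZY)
      refine hX (Z ∩ X) Set.inter_subset_right ?_ ?_
      · rw [← Set.sdiff_sdiff_right_self]
        exact hZ.sdiff hfin
      · obtain ⟨M, hM⟩ := nextElt_inter_eventually hfin
        have hq : nodeSwap (nextElt (Z ∩ X)) * nodeSwap (nextElt Z) ∈ H i :=
          (le_sup_right : _ ≤ H i) (Subgroup.subset_closure
            ⟨_, _, M, fun m hm => (hM m hm).symm, rfl⟩)
        simpa [mul_assoc] using (H i).mul_mem hq ((H i).inv_mem hmem))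
    (fun i X hX => exists_dense_nodeSwap_notMem (hH i) hX)
  refine ⟨E.symm (nodeSwap (nextElt X)), fun i hi => hXH i X subset_rfl hX ?_⟩
  exact (le_sup_left : _ ≤ H i) ⟨_, hi, by simp⟩

-- Chains of uncountable length and the ultraproduct chain

end CofSpectrum
namespace CofSpectrum
open Cardinal

theorem exists_forall_lt_of_countable {c : Cardinal.{0}} (hc : c.IsRegular) (hc' : ℵ₀ < c)
    {s : Set c.ord.ToType} (hs : s.Countable) : ∃ j, ∀ i ∈ s, i < j := by
  by_contra! h
  have h1 : Order.cof c.ord.ToType ≤ #s := Order.cof_le h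
  rw [Ordinal.cof_toType, hc.cof_ord] at h1
  exact absurd (h1.trans (le_aleph0_iff_set_countable.2 hs)) (not_le.2 hc')

/-- By regularity, countably many added generators already lie in one later, still proper, member of
the chain. -/
theorem hasUncountableCodim_of_chain {Γ : Type} [Group Γ] {c : Cardinal.{0}} (hc : c.IsRegular)
    (hc' : ℵ₀ < c) {H : c.ord.ToType → Subgroup Γ} (hmono : Monotone H) (htop : ∀ i, H i ≠ ⊤)
    (hcover : ∀ g, ∃ i, g ∈ H i) (i : c.ord.ToType) : HasUncountableCodim (H i) := by
  intro C hC h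
  choose k hk using hcover
  obtain ⟨j, hj⟩ := exists_forall_lt_of_countable hc hc' ((hC.image k).insert i)
  refine htop j (top_le_iff.1 (h ▸ sup_le (hmono (hj i (by simp)).le) ?_))
  rw [Subgroup.closure_le]
  exact fun g hg => hmono (hj (k g) (by simp [Set.mem_image_of_mem k hg])).le (hk g)

end CofSpectrum

theorem theorem2p2 (κ : Cardinal.{0}) (hMA : CofSpectrum.MA κ)
    (lam : κ.ord.ToType → Cardinal.{0}) (hmono : StrictMono lam)
    (hlam : ∀ α, lam α ∈ CofSpectrum.CF (Equiv.Perm ℕ))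
    (D : Ultrafilter κ.ord.ToType) (hD : ∀ α, D ≠ pure α)
    (μ : Cardinal.{0}) (hμ : CofSpectrum.IsTrueCofinality (D : Filter κ.ord.ToType) lam μ) :
    μ ∈ CofSpectrum.CF (Equiv.Perm ℕ) := by
  have hκ : Cardinal.aleph0 ≤ κ := by
    by_contra hlt
    have : Finite κ.ord.ToType := by
      rw [← Cardinal.lt_aleph0_iff_finite, Cardinal.mk_ord_toType]
      exact not_le.1 hlt
    obtain ⟨α, hα⟩ := D.eq_pure_of_finite
    exact hD α hα
  -- The injective sequence `lam` takes the value ℵ₀ at most once, and a nonprincipal ultrafilter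
  -- ignores a single index.
  have hunc : ∀ᶠ α in (D : Filter κ.ord.ToType), Cardinal.aleph0 < lam α := by
    by_contra hall
    rw [← Ultrafilter.eventually_not] at hall
    obtain ⟨α, hα⟩ : ∃ α, lam α = Cardinal.aleph0 := by
      obtain ⟨α, hα⟩ := hall.exists
      exact ⟨α, le_antisymm (not_lt.1 hα) (hlam α).1.aleph0_le⟩
    refine hD α (Ultrafilter.eq_of_le (Filter.le_pure_iff.2 ?_))
    filter_upwards [hall] with β hβ
    exact hmono.injective (hα ▸ le_antisymm (not_lt.1 hβ) (hlam β).1.aleph0_le)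
  choose hreg H hH htop hcover using hlam
  obtain ⟨hμreg, f, hf, hfcof⟩ := hμ
  refine ⟨hμreg, fun b =>
    { carrier := {g | ∀ᶠ α in (D : Filter κ.ord.ToType), g ∈ H α (f b α)}
      mul_mem' := fun {a b} ha hb => by
        filter_upwards [ha, hb] with α h1 h2 using mul_mem h1 h2
      one_mem' := Filter.Eventually.of_forall fun α => one_mem _
      inv_mem' := fun {a} ha => by
        filter_upwards [ha] with α h1 using inv_mem h1 }, ?_, ?_, ?_⟩
  · intro b c hbc g hg
    rcases hbc.eq_or_lt with rfl | hlt
    · exact hg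
    · filter_upwards [hf b c hlt, hg] with α h1 h2 using hH α h1.le h2
  · intro b hb
    -- This `u` avoids `H α (f b α)` at every index with `lam α` uncountable, that is, `D`-almost
    -- everywhere.
    obtain ⟨u, hu⟩ := hMA.exists_forall_notMem hκ
      (I := {α : κ.ord.ToType // Cardinal.aleph0 < lam α})
      ((Cardinal.mk_subtype_le _).trans (Cardinal.mk_ord_toType κ).le)
      (fun α => H α (f b α))
      (fun α => CofSpectrum.hasUncountableCodim_of_chain (hreg α) α.2 (hH α) (htop α) (hcover α) _)
    have hub : ∀ᶠ α in (D : Filter κ.ord.ToType), u ∈ H α (f b α) :=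
      (Subgroup.eq_top_iff' _).1 hb u
    obtain ⟨α, h1, h2⟩ := (hub.and hunc).exists
    exact hu ⟨α, h2⟩ h1
  · intro g
    choose h hh using fun α => hcover α g
    obtain ⟨b, hb⟩ := hfcof h
    exact ⟨b, by filter_upwards [hb] with α hα using hH α hα.le (hh α)⟩
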